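/- Let $E=(E^0,E^1,r,s)$ be a row-finite directed graph (every vertex $v$ emits only finitely many edges, i.e. $s^{-1}(v)$ is finite), let $K$ be a field, and let $L_K(E)$ be the Leavitt path algebra of $E$: the universal (associative, not necessarily unital) $K$-algebra generated by pairwise orthogonal idempotents $\{v : v\in E^0\}$ and elements $\{e,e^* : e\in E^1\}$ subject to $s(e)e=e\,r(e)=e$, $r(e)e^*=e^*s(e)=e^*$, $e^*f=\delta_{e,f}\,r(e)$ for all $e,f\in E^1$, and $v=\sum_{s(e)=v}ee^*$ for every $v\in E^0$ with $s^{-1}(v)$ finite and nonempty. Let $E^*$ be the set of finite paths of $E$, including the vertices as paths of length $0$, and grade $L_K(E)$ over $\mathbb{Z}$ by $L_K(E)_n=\operatorname{span}_K\{\alpha\beta^* : \alpha,\beta\in E^*,\ |\alpha|-|\beta|=n\}$. For a two-sided ideal $J$ of $L_K(E)$ put $H(J)=\{v\in E^0 : v\in J\}$ and $\overline{H}(J)=\{s(\alpha) : \alpha\in E^*,\ r(\alpha)\in H(J)\}$. For $w\in E^0$ put $T(w)=\{r(\alpha) : \alpha\in E^*,\ s(\alpha)=w\}$. For $H\subseteq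 E^0$ let $I(H)$ be the two-sided ideal of $L_K(E)$ generated by $H$. For $X\subseteq L_K(E)$ let $X^\perp=\{a\in L_K(E) : ax=xa=0 \text{ for all } x\in X\}$, and call an ideal $J$ regular if $J=J^{\perp\perp}$. Let $J$ be a graded ideal of $L_K(E)$, i.e. $J=\bigoplus_{n\in\mathbb{Z}}(J\cap L_K(E)_n)$. Then: 1. $J^\perp=I\bigl(E^0\setminus\overline{H}(J)\bigr)$; 2. $J^{\perp\perp}=I\bigl(\{w\in E^0 : T(w)\subseteq\overline{H}(J)\}\bigr)$; 3. $J$ is regular if and only if $H(J)=\{w\in E^0 : T(w)\subseteq\overline{H}(J)\}$. -/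

import Mathlib

universe u v w

/-- A directed graph `(E⁰, E¹, r, s)` with vertex set `V` and edge set `Edge`. -/
structure DirectedGraph (V : Type u) (Edge : Type v) where
  /-- the source map -/
  s : Edge → V
  /-- the range map -/
  r : Edge → V

namespace DirectedGraph

variable {V : Type u} {Edge : Type v}

/-- Every vertex emits only finitely many edges. -/
def RowFinite (E : DirectedGraph V Edge) : Prop :=
  ∀ v : V, {e : Edge | E.s e = v}.Finite

/-- `E.Path a b` is the type of finite paths `α` with `s(α) = a` and `r(α) = b`;
the trivial path at `a` is the vertex `a` itself. -/
inductive Path (E : DirectedGraph V Edge) : V → V → Type (max u v)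
  | nil (a : V) : Path E a a
  | cons {a b : V} (e : Edge) (h : E.s e = a) (p : Path E (E.r e) b) : Path E a b

/-- The length of a path. -/
def Path.length {E : DirectedGraph V Edge} : {a b : V} → E.Path a b → ℕ
  | _, _, .nil _ => 0
  | _, _, .cons _ _ p => p.length + 1

/-- The tree `T(a) = {r(α) : s(α) = a}`. -/
def tree (E : DirectedGraph V Edge) (a : V) : Set V :=
  {b | Nonempty (E.Path a b)}

end DirectedGraph

namespace LeavittPathAlgebra

/-- The generators: vertices, edges `e` and ghost edges `e*`. -/
inductive Gen (V : Type u) (Edge : Type v) : Type (max u v)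
  | vertex (a : V) : Gen V Edge
  | edge (e : Edge) : Gen V Edge
  | ghost (e : Edge) : Gen V Edge

/-- The free (associative, not necessarily unital) `K`-algebra on the generators. -/
abbrev Free (V : Type u) (Edge : Type v) (K : Type w) [Field K] : Type (max u v w) :=
  MonoidAlgebra K (FreeSemigroup (Gen V Edge))

/-- A generator as an element of the free algebra. -/
noncomputable def gen {V : Type u} {Edge : Type v} (K : Type w) [Field K] (x : Gen V Edge) :
    Free V Edge K :=
  MonoidAlgebra.single (FreeSemigroup.of x) 1

open Gen in
/-- The defining relations of the Leavitt path algebra. The constructor `smul` makes the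
ring congruence that they generate compatible with scalars, which is not automatic in the
absence of a unit. -/
inductive Rel {V : Type u} {Edge : Type v} (E : DirectedGraph V Edge) (K : Type w) [Field K] :
    Free V Edge K → Free V Edge K → Prop
  | vertex_idem (a : V) :
      Rel E K (gen K (vertex a) * gen K (vertex a)) (gen K (vertex a))
  | vertex_orth (a b : V) (h : a ≠ b) :
      Rel E K (gen K (vertex a) * gen K (vertex b)) 0
  | source_edge (e : Edge) :
      Rel E K (gen K (vertex (E.s e)) * gen K (edge e)) (gen K (edge e))
  | edge_range (e : Edge) :
      Rel E K (gen K (edge e) * gen K (vertex (E.r e))) (gen K (edge e))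
  | range_ghost (e : Edge) :
      Rel E K (gen K (vertex (E.r e)) * gen K (ghost e)) (gen K (ghost e))
  | ghost_source (e : Edge) :
      Rel E K (gen K (ghost e) * gen K (vertex (E.s e))) (gen K (ghost e))
  | ghost_edge_self (e : Edge) :
      Rel E K (gen K (ghost e) * gen K (edge e)) (gen K (vertex (E.r e)))
  | ghost_edge_ne (e f : Edge) (h : e ≠ f) :
      Rel E K (gen K (ghost e) * gen K (edge f)) 0
  | vertex_eq_sum (a : V) (F : Finset Edge) (hF : ∀ e, e ∈ F ↔ E.s e = a) (hne : F.Nonempty) :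
      Rel E K (gen K (vertex a)) (∑ e ∈ F, gen K (edge e) * gen K (ghost e))
  | smul (k : K) (x y : Free V Edge K) (h : Rel E K x y) : Rel E K (k • x) (k • y)

/-- The ring congruence generated by the defining relations. -/
noncomputable def con {V : Type u} {Edge : Type v} (E : DirectedGraph V Edge) (K : Type w) [Field K] :
    RingCon (Free V Edge K) :=
  ringConGen (Rel E K)

theorem con_smul {V : Type u} {Edge : Type v} (E : DirectedGraph V Edge) (K : Type w) [Field K]
    (k : K) {x y : Free V Edge K} (h : con E K x y) : con E K (k • x) (k • y) := by
  change RingConGen.Rel (Rel E K) x y at h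
  change RingConGen.Rel (Rel E K) (k • x) (k • y)
  induction h with
  | of x y h => exact .of _ _ (.smul k x y h)
  | refl x => exact .refl _
  | symm _ ih => exact .symm ih
  | trans _ _ ih₁ ih₂ => exact .trans ih₁ ih₂
  | add _ _ ih₁ ih₂ => rw [smul_add, smul_add]; exact .add ih₁ ih₂
  | mul _ h₂ ih₁ _ => rw [← smul_mul_assoc, ← smul_mul_assoc]; exact .mul ih₁ h₂

end LeavittPathAlgebra

/-- The Leavitt path algebra `L_K(E)`: the universal (not necessarily unital) `K`-algebra on the
vertices, edges and ghost edges subject to the defining relations. -/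
def LeavittPathAlgebra {V : Type u} {Edge : Type v} (E : DirectedGraph V Edge)
    (K : Type w) [Field K] : Type (max u v w) :=
  (LeavittPathAlgebra.con E K).Quotient

namespace LeavittPathAlgebra

variable {V : Type u} {Edge : Type v} (E : DirectedGraph V Edge) (K : Type w) [Field K]

noncomputable instance : NonUnitalRing (LeavittPathAlgebra E K) :=
  inferInstanceAs (NonUnitalRing (con E K).Quotient)

/-- The quotient map from the free algebra. -/
noncomputable def mk (x : Free V Edge K) : LeavittPathAlgebra E K :=
  RingCon.toQuotient (c := con E K) x

noncomputable instance : SMul K (LeavittPathAlgebra E K) where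
  smul k := Quotient.map' (fun x => k • x) fun _ _ h => con_smul E K k h

noncomputable instance : Module K (LeavittPathAlgebra E K) where
  one_smul := by rintro ⟨x⟩; exact congrArg (mk E K) (one_smul K x)
  mul_smul := by rintro k l ⟨x⟩; exact congrArg (mk E K) (mul_smul k l x)
  smul_zero k := congrArg (mk E K) (smul_zero k)
  smul_add := by rintro k ⟨x⟩ ⟨y⟩; exact congrArg (mk E K) (smul_add k x y)
  add_smul := by rintro k l ⟨x⟩; exact congrArg (mk E K) (add_smul k l x)
  zero_smul := by rintro ⟨x⟩; exact congrArg (mk E K) (zero_smul K x)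

instance : IsScalarTower K (LeavittPathAlgebra E K) (LeavittPathAlgebra E K) where
  smul_assoc := by rintro k ⟨x⟩ ⟨y⟩; exact congrArg (mk E K) (smul_mul_assoc k x y)

instance : SMulCommClass K (LeavittPathAlgebra E K) (LeavittPathAlgebra E K) where
  smul_comm := by rintro k ⟨x⟩ ⟨y⟩; exact congrArg (mk E K) (mul_smul_comm k x y).symm

/-- The vertex `a` as an element of `L_K(E)`. -/
noncomputable def vertex (a : V) : LeavittPathAlgebra E K := mk E K (gen K (.vertex a))

/-- The edge `e` as an element of `L_K(E)`. -/
noncomputable def edge (e : Edge) : LeavittPathAlgebra E K := mk E K (gen K (.edge e))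

/-- The ghost edge `e*` as an element of `L_K(E)`. -/
noncomputable def ghost (e : Edge) : LeavittPathAlgebra E K := mk E K (gen K (.ghost e))

variable {E}

/-- The path `α = e₁⋯eₙ` as an element of `L_K(E)`, written `e₁⋯eₙ r(eₙ)`. -/
noncomputable def path : {a b : V} → E.Path a b → LeavittPathAlgebra E K
  | _, _, .nil a => vertex E K a
  | _, _, .cons e _ p => edge E K e * path p

/-- The ghost path `α* = eₙ*⋯e₁*` as an element of `L_K(E)`, written `r(eₙ) eₙ*⋯e₁*`. -/
noncomputable def ghostPath : {a b : V} → E.Path a b → LeavittPathAlgebra E K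
  | _, _, .nil a => vertex E K a
  | _, _, .cons e _ p => ghostPath p * ghost E K e

variable (E)

/-- The homogeneous component of degree `n`: the span of all `α β*` with `|α| - |β| = n`. -/
noncomputable def component (n : ℤ) : Submodule K (LeavittPathAlgebra E K) :=
  Submodule.span K {x | ∃ (a b c d : V) (α : E.Path a b) (β : E.Path c d),
    (α.length : ℤ) - (β.length : ℤ) = n ∧ x = path K α * ghostPath K β}

variable {E K}

/-- `J` is graded: `J = ⨁ₙ (J ∩ L_K(E)ₙ)`, i.e. every element of `J` is a finite sum of
homogeneous elements of `J` (the sum is direct because `L_K(E) = ⨁ₙ L_K(E)ₙ`). -/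
def IsGraded (J : TwoSidedIdeal (LeavittPathAlgebra E K)) : Prop :=
  ∀ x ∈ J, ∃ y : ℤ →₀ LeavittPathAlgebra E K,
    (∀ n, y n ∈ J ∧ y n ∈ component E K n) ∧ x = y.sum fun _ z => z

/-- `H(J)`, the set of vertices in `J`. -/
def vertexSet (J : TwoSidedIdeal (LeavittPathAlgebra E K)) : Set V :=
  {a | vertex E K a ∈ J}

/-- `H̄(J) = {s(α) : r(α) ∈ H(J)}`. -/
def vertexSetBar (J : TwoSidedIdeal (LeavittPathAlgebra E K)) : Set V :=
  {a | ∃ (b : V) (_ : E.Path a b), b ∈ vertexSet J}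

variable (E K)

/-- `I(H)`, the two-sided ideal generated by the vertices in `H`. -/
noncomputable def idealOf (H : Set V) : TwoSidedIdeal (LeavittPathAlgebra E K) :=
  TwoSidedIdeal.span (vertex E K '' H)

end LeavittPathAlgebra

/-- The two-sided annihilator `X^⊥`. -/
def perp {A : Type*} [NonUnitalRing A] (X : Set A) : Set A :=
  {a | ∀ x ∈ X, a * x = 0 ∧ x * a = 0}

/-- An ideal `J` is regular if `J = J^⊥⊥`. -/
def IsRegularIdeal {A : Type*} [NonUnitalRing A] (J : TwoSidedIdeal A) : Prop :=
  (J : Set A) = perp (perp (J : Set A))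

/-! Over a row-finite graph, a graded ideal is generated by the vertices it contains
(`IsGraded.eq_idealOf`). The annihilator of a graded ideal is again graded (`IsGraded.perpIdeal`),
so J^⊥ and J^⊥⊥ are determined by their vertices, and only those have to be computed.

A vertex w lies in J^⊥ exactly when w ∉ H̄(J). If a path leads from w ∈ J^⊥ to b ∈ H(J), then b ∈ J
∩ J^⊥, so b = b·b = 0, contradicting `vertex_ne_zero`. Otherwise, since H(J) is closed under
following paths, no vertex is reachable both from w and from H(J); then w L h = 0 = h L w for every
h ∈ H(J), and w annihilates I(H(J)) = J.

This gives the formula for J^⊥. The same formula applied to J^⊥, with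
`IsGraded.compl_vertexSetBar_perpIdeal`, gives J^⊥⊥. Regularity is then the equality of two graded
ideals, which can be tested on vertices.

Two facts about L_K(E) need explicit models: vertices are nonzero (a representation on functions on
V × ℕ), and homogeneous components are independent enough to split annihilation by degree (an action
on Laurent polynomials over L_K(E)). -/

namespace LeavittPathAlgebra

/-! ### Defining relations and induction on words -/

section Relations

variable {V : Type*} {Edge : Type*} (E : DirectedGraph V Edge) (K : Type*) [Field K]

theorem mk_eq_of_rel {x y : Free V Edge K} (h : Rel E K x y) : mk E K x = mk E K y :=
  Quotient.sound' (RingConGen.Rel.of _ _ h)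

theorem mk_sum {ι : Type*} (F : Finset ι) (f : ι → Free V Edge K) :
    mk E K (∑ i ∈ F, f i) = ∑ i ∈ F, mk E K (f i) :=
  map_sum (⟨⟨mk E K, rfl⟩, fun _ _ => rfl⟩ : Free V Edge K →+ LeavittPathAlgebra E K) f F

@[simp]
theorem vertex_mul_self (a : V) : vertex E K a * vertex E K a = vertex E K a :=
  mk_eq_of_rel E K (.vertex_idem a)

theorem vertex_mul_vertex_of_ne {a b : V} (h : a ≠ b) : vertex E K a * vertex E K b = 0 :=
  mk_eq_of_rel E K (.vertex_orth a b h)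

@[simp]
theorem source_mul_edge (e : Edge) : vertex E K (E.s e) * edge E K e = edge E K e :=
  mk_eq_of_rel E K (.source_edge e)

@[simp]
theorem edge_mul_range (e : Edge) : edge E K e * vertex E K (E.r e) = edge E K e :=
  mk_eq_of_rel E K (.edge_range e)

@[simp]
theorem range_mul_ghost (e : Edge) : vertex E K (E.r e) * ghost E K e = ghost E K e :=
  mk_eq_of_rel E K (.range_ghost e)

@[simp]
theorem ghost_mul_source (e : Edge) : ghost E K e * vertex E K (E.s e) = ghost E K e :=
  mk_eq_of_rel E K (.ghost_source e)

@[simp]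
theorem ghost_mul_edge_self (e : Edge) : ghost E K e * edge E K e = vertex E K (E.r e) :=
  mk_eq_of_rel E K (.ghost_edge_self e)

theorem ghost_mul_edge_of_ne {e f : Edge} (h : e ≠ f) : ghost E K e * edge E K f = 0 :=
  mk_eq_of_rel E K (.ghost_edge_ne e f h)

theorem vertex_eq_sum (a : V) (F : Finset Edge) (hF : ∀ e, e ∈ F ↔ E.s e = a)
    (hne : F.Nonempty) : vertex E K a = ∑ e ∈ F, edge E K e * ghost E K e :=
  (mk_eq_of_rel E K (.vertex_eq_sum a F hF hne)).trans (mk_sum E K F _)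

theorem vertex_mul_edge_of_ne {a : V} {e : Edge} (h : a ≠ E.s e) :
    vertex E K a * edge E K e = 0 := by
  rw [← source_mul_edge, ← mul_assoc, vertex_mul_vertex_of_ne E K h, zero_mul]

theorem ghost_mul_vertex_of_ne {a : V} {e : Edge} (h : E.s e ≠ a) :
    ghost E K e * vertex E K a = 0 := by
  rw [← ghost_mul_source, mul_assoc, vertex_mul_vertex_of_ne E K h, mul_zero]

/-- In a row-finite graph, a vertex is a sink or the sum of the `e e*` over the edges it emits. -/
theorem sink_or_vertex_eq_sum (hE : E.RowFinite) (a : V) :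
    (∀ e, E.s e ≠ a) ∨ ∃ F : Finset Edge, vertex E K a = ∑ e ∈ F, edge E K e * ghost E K e := by
  by_cases h : ∃ e, E.s e = a
  · obtain ⟨e, he⟩ := h
    exact .inr ⟨(hE a).toFinset, vertex_eq_sum E K a _ (by simp) ⟨e, by simpa using he⟩⟩
  · exact .inl (by simpa using h)

variable {E K}

/-- Induction on words in the generators. -/
theorem induction_on {P : LeavittPathAlgebra E K → Prop} (x : LeavittPathAlgebra E K)
    (gen_mem : ∀ g, P (mk E K (gen K g)))
    (gen_mul : ∀ g y, P y → P (mk E K (gen K g) * y))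
    (zero : P 0) (add : ∀ y z, P y → P z → P (y + z)) (smul : ∀ (k : K) y, P y → P (k • y)) :
    P x := by
  obtain ⟨x, rfl⟩ : ∃ y, mk E K y = x := Quotient.exists_rep x
  have word : ∀ w : FreeSemigroup (Gen V Edge), P (mk E K (MonoidAlgebra.single w 1)) := by
    intro w
    induction w using FreeSemigroup.recOnMul with
    | ih1 g => exact gen_mem g
    | ih2 g w _ hw =>
      have := gen_mul g _ hw
      have h : MonoidAlgebra.single (FreeSemigroup.of g * w) (1 : K) =
          gen K g * MonoidAlgebra.single w 1 := by
        rw [gen, MonoidAlgebra.single_mul_single, one_mul]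
      rw [h]
      exact this
  induction x using MonoidAlgebra.induction_linear with
  | zero => exact zero
  | add y z hy hz => exact add _ _ hy hz
  | single w k =>
    have h : MonoidAlgebra.single w k = k • MonoidAlgebra.single w (1 : K) := by
      simp
    rw [h]
    exact smul k _ (word w)

end Relations

/-! ### Universal property -/

section Lift

variable {V : Type*} {Edge : Type*} (E : DirectedGraph V Edge) {K : Type*} [Field K]
variable {B : Type*} [Ring B] [Algebra K B]

/-- The defining relations of `L_K(E)` for families of elements of a `K`-algebra. -/
structure IsLeavittFamily (p : V → B) (q t : Edge → B) : Prop where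
  vertex_idem : ∀ a, p a * p a = p a
  vertex_orth : ∀ a b, a ≠ b → p a * p b = 0
  source_edge : ∀ e, p (E.s e) * q e = q e
  edge_range : ∀ e, q e * p (E.r e) = q e
  range_ghost : ∀ e, p (E.r e) * t e = t e
  ghost_source : ∀ e, t e * p (E.s e) = t e
  ghost_edge_self : ∀ e, t e * q e = p (E.r e)
  ghost_edge_ne : ∀ e f, e ≠ f → t e * q f = 0
  vertex_eq_sum : ∀ (a : V) (F : Finset Edge), (∀ e, e ∈ F ↔ E.s e = a) → F.Nonempty →
    p a = ∑ e ∈ F, q e * t e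

variable {E}

/-- The universal property of `L_K(E)`. -/
theorem exists_lift {p : V → B} {q t : Edge → B} (h : IsLeavittFamily E p q t) :
    ∃ φ : LeavittPathAlgebra E K →ₙₐ[K] B,
      (∀ a, φ (vertex E K a) = p a) ∧ (∀ e, φ (edge E K e) = q e) ∧
        ∀ e, φ (ghost E K e) = t e := by
  let g : Gen V Edge → B := fun
    | .vertex a => p a
    | .edge e => q e
    | .ghost e => t e
  let ψ : Free V Edge K →ₙₐ[K] B := MonoidAlgebra.liftMagma K (FreeSemigroup.lift g)
  have hψ : ∀ x, ψ (gen K x) = g x := fun x => by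
    simp [ψ, gen, MonoidAlgebra.liftMagma_apply_apply]
  have hrel : ∀ x y, Rel E K x y → ψ x = ψ y := by
    intro x y hxy
    induction hxy with
    | vertex_idem a => simpa [hψ] using h.vertex_idem a
    | vertex_orth a b hab => simpa [hψ] using h.vertex_orth a b hab
    | source_edge e => simpa [hψ] using h.source_edge e
    | edge_range e => simpa [hψ] using h.edge_range e
    | range_ghost e => simpa [hψ] using h.range_ghost e
    | ghost_source e => simpa [hψ] using h.ghost_source e
    | ghost_edge_self e => simpa [hψ] using h.ghost_edge_self e
    | ghost_edge_ne e f hef => simpa [hψ] using h.ghost_edge_ne e f hef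
    | vertex_eq_sum a F hF hne => simpa [hψ, map_sum] using h.vertex_eq_sum a F hF hne
    | smul k x y _ ih => rw [map_smul, map_smul, ih]
  have hcon : ∀ x y, con E K x y → ψ x = ψ y := by
    intro x y hxy
    change RingConGen.Rel (Rel E K) x y at hxy
    induction hxy with
    | of x y h => exact hrel x y h
    | refl x => rfl
    | symm _ ih => exact ih.symm
    | trans _ _ ih₁ ih₂ => exact ih₁.trans ih₂
    | add _ _ ih₁ ih₂ => rw [map_add, map_add, ih₁, ih₂]
    | mul _ _ ih₁ ih₂ => rw [map_mul, map_mul, ih₁, ih₂]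
  refine ⟨{ toFun := fun x => Quotient.liftOn' x ψ hcon
            map_smul' := ?_, map_zero' := map_zero ψ, map_add' := ?_, map_mul' := ?_ },
    fun a => hψ _, fun e => hψ _, fun e => hψ _⟩
  · rintro k ⟨x⟩; exact map_smul ψ k x
  · rintro ⟨x⟩ ⟨y⟩; exact map_add ψ x y
  · rintro ⟨x⟩ ⟨y⟩; exact map_mul ψ x y

end Lift

/-! ### Path calculus and the spanning monomials -/

section Paths

variable {V : Type*} {Edge : Type*} {E : DirectedGraph V Edge} (K : Type*) [Field K]

@[simp]
theorem source_mul_path {a b : V} (α : E.Path a b) : vertex E K a * path K α = path K α := by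
  cases α with
  | nil => exact vertex_mul_self E K _
  | cons e h p => subst h; rw [path, ← mul_assoc, source_mul_edge]

@[simp]
theorem path_mul_range {a b : V} (α : E.Path a b) : path K α * vertex E K b = path K α := by
  induction α with
  | nil => exact vertex_mul_self E K _
  | cons e h p ih => rw [path, mul_assoc, ih]

@[simp]
theorem range_mul_ghostPath {a b : V} (α : E.Path a b) :
    vertex E K b * ghostPath K α = ghostPath K α := by
  induction α with
  | nil => exact vertex_mul_self E K _
  | cons e h p ih => rw [ghostPath, ← mul_assoc, ih]

@[simp]
theorem ghostPath_mul_source {a b : V} (α : E.Path a b) :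
    ghostPath K α * vertex E K a = ghostPath K α := by
  cases α with
  | nil => exact vertex_mul_self E K _
  | cons e h p => subst h; rw [ghostPath, mul_assoc, ghost_mul_source]

theorem ghostPath_mul_path_self {a b : V} (α : E.Path a b) :
    ghostPath K α * path K α = vertex E K b := by
  induction α with
  | nil => exact vertex_mul_self E K _
  | cons e h p ih =>
    rw [path, ghostPath, mul_assoc, ← mul_assoc (ghost E K e), ghost_mul_edge_self,
      source_mul_path, ih]

theorem path_mul_ghostPath_of_ne {a b c d : V} (α : E.Path a b) (β : E.Path c d) (h : b ≠ d) :
    path K α * ghostPath K β = 0 := by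
  rw [← path_mul_range, mul_assoc, ← range_mul_ghostPath, ← mul_assoc (vertex E K b),
    vertex_mul_vertex_of_ne E K h, zero_mul, mul_zero]

theorem vertex_mul_path_of_ne {a b c : V} (α : E.Path a b) (h : c ≠ a) :
    vertex E K c * path K α = 0 := by
  rw [← source_mul_path, ← mul_assoc, vertex_mul_vertex_of_ne E K h, zero_mul]

theorem ghostPath_mul_vertex_of_ne {a b c : V} (α : E.Path a b) (h : a ≠ c) :
    ghostPath K α * vertex E K c = 0 := by
  rw [← ghostPath_mul_source, mul_assoc, vertex_mul_vertex_of_ne E K h, mul_zero]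

/-- Appending an edge at the end of a path. -/
theorem exists_path_snoc {a b : V} (α : E.Path a b) (e : Edge) (h : E.s e = b) :
    ∃ β : E.Path a (E.r e), β.length = α.length + 1 ∧ path K β = path K α * edge E K e ∧
      ghostPath K β = ghost E K e * ghostPath K α := by
  induction α with
  | nil a =>
    subst h
    exact ⟨.cons e rfl (.nil _), rfl, by simp [path], by simp [ghostPath]⟩
  | cons f hf p ih =>
    obtain ⟨β, hl, hp, hg⟩ := ih h
    exact ⟨.cons f hf β, by simp [DirectedGraph.Path.length, hl], by simp [path, hp, mul_assoc],
      by simp [ghostPath, hg, mul_assoc]⟩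

theorem vertex_mem_component (a : V) : vertex E K a ∈ component E K 0 :=
  Submodule.subset_span ⟨a, a, a, a, .nil a, .nil a, by simp, by simp [path, ghostPath]⟩

theorem monomial_mem_component {a b c d : V} (α : E.Path a b) (β : E.Path c d) {n : ℤ}
    (h : (α.length : ℤ) - β.length = n) : path K α * ghostPath K β ∈ component E K n :=
  Submodule.subset_span ⟨a, b, c, d, α, β, h, rfl⟩

theorem edge_mem_component (e : Edge) : edge E K e ∈ component E K 1 := by
  have := monomial_mem_component K (.cons e rfl (.nil _) : E.Path (E.s e) (E.r e)) (.nil (E.r e))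
    (n := 1) (by simp [DirectedGraph.Path.length])
  simpa [path, ghostPath] using this

theorem ghost_mem_component (e : Edge) : ghost E K e ∈ component E K (-1) := by
  have := monomial_mem_component K (.nil (E.r e)) (.cons e rfl (.nil _) : E.Path (E.s e) (E.r e))
    (n := -1) (by simp [DirectedGraph.Path.length])
  simpa [path, ghostPath] using this

variable {K}

/-- Monomials α β* with r(α) ≠ r(β) vanish, so only those with matching ranges need checking. -/
theorem component_le {n : ℤ} {S : Submodule K (LeavittPathAlgebra E K)}
    (h : ∀ {a b c} (α : E.Path a b) (β : E.Path c b), (α.length : ℤ) - β.length = n →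
      path K α * ghostPath K β ∈ S) : component E K n ≤ S := by
  refine Submodule.span_le.2 ?_
  rintro _ ⟨a, b, c, d, α, β, hl, rfl⟩
  by_cases hbd : b = d
  · subst hbd; exact h α β hl
  · rw [path_mul_ghostPath_of_ne K α β hbd]; exact zero_mem _

theorem vertex_mul_mem_component (v : V) {n : ℤ} {x : LeavittPathAlgebra E K}
    (hx : x ∈ component E K n) : vertex E K v * x ∈ component E K n := by
  refine component_le (S := (component E K n).comap (LinearMap.mulLeft K (vertex E K v)))
    (fun {a b c} α β hl => ?_) hx
  rw [Submodule.mem_comap, LinearMap.mulLeft_apply]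
  by_cases h : v = a
  · subst h
    rw [← mul_assoc, source_mul_path]
    exact monomial_mem_component K α β hl
  · rw [← mul_assoc, vertex_mul_path_of_ne K α h, zero_mul]
    exact zero_mem _

theorem edge_mul_mem_component (e : Edge) {n : ℤ} {x : LeavittPathAlgebra E K}
    (hx : x ∈ component E K n) : edge E K e * x ∈ component E K (1 + n) := by
  refine component_le (S := (component E K (1 + n)).comap (LinearMap.mulLeft K (edge E K e)))
    (fun {a b c} α β hl => ?_) hx
  rw [Submodule.mem_comap, LinearMap.mulLeft_apply]
  by_cases h : E.r e = a
  · subst h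
    exact (mul_assoc (edge E K e) _ _) ▸ monomial_mem_component K (.cons e rfl α) β
      (by simp [DirectedGraph.Path.length]; omega)
  · rw [← mul_assoc, ← edge_mul_range, mul_assoc _ _ (path K α), vertex_mul_path_of_ne K α h,
      mul_zero, zero_mul]
    exact zero_mem _

theorem ghost_mul_mem_component (e : Edge) {n : ℤ} {x : LeavittPathAlgebra E K}
    (hx : x ∈ component E K n) : ghost E K e * x ∈ component E K (-1 + n) := by
  refine component_le (S := (component E K (-1 + n)).comap (LinearMap.mulLeft K (ghost E K e)))
    (fun {a b c} α β hl => ?_) hx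
  rw [Submodule.mem_comap, LinearMap.mulLeft_apply]
  cases α with
  | nil =>
    by_cases h : E.s e = a
    -- With α trivial, the new ghost edge is absorbed on the other side: e* β* = (β e)*.
    · obtain ⟨γ, hγ, -, hg⟩ := exists_path_snoc K β e h
      have := monomial_mem_component K (.nil (E.r e)) γ (n := -1 + n)
        (by simp [DirectedGraph.Path.length] at hl ⊢; omega)
      rw [path, range_mul_ghostPath]
      rwa [path, range_mul_ghostPath, hg] at this
    · rw [path, ← mul_assoc, ghost_mul_vertex_of_ne E K h, zero_mul]
      exact zero_mem _
  | cons f hf p =>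
    rw [path, ← mul_assoc, ← mul_assoc]
    by_cases h : e = f
    · subst h
      rw [ghost_mul_edge_self, source_mul_path]
      exact monomial_mem_component K p β (by simp [DirectedGraph.Path.length] at hl; omega)
    · rw [ghost_mul_edge_of_ne E K h, zero_mul, zero_mul]
      exact zero_mem _

/-- `L_K(E)` is the sum of its homogeneous components. -/
theorem mem_iSup_component (x : LeavittPathAlgebra E K) : x ∈ ⨆ n, component E K n := by
  -- Left multiplication by a generator shifts degree by 0, 1 or -1, so the sum of the components
  -- absorbs words one letter at a time.
  have mono (n : ℤ) : component E K n ≤ ⨆ n, component E K n := le_iSup _ n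
  induction x using induction_on with
  | gen_mem g =>
    cases g with
    | vertex a => exact mono _ (vertex_mem_component K a)
    | edge e => exact mono _ (edge_mem_component K e)
    | ghost e => exact mono _ (ghost_mem_component K e)
  | gen_mul g y hy =>
    induction hy using Submodule.iSup_induction' with
    | mem n y hy =>
      cases g with
      | vertex a => exact mono _ (vertex_mul_mem_component a hy)
      | edge e => exact mono _ (edge_mul_mem_component e hy)
      | ghost e => exact mono _ (ghost_mul_mem_component e hy)
    | zero => rw [mul_zero]; exact zero_mem _
    | add y z _ _ hy hz => rw [mul_add]; exact add_mem hy hz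
  | zero => exact zero_mem _
  | add y z hy hz => exact add_mem hy hz
  | smul k y hy => exact Submodule.smul_mem _ k hy

/-- The monomials `α β*` with `r(α) = r(β)` span `L_K(E)`. -/
theorem mem_of_monomial_mem {S : Submodule K (LeavittPathAlgebra E K)}
    (h : ∀ {a b c} (α : E.Path a b) (β : E.Path c b), path K α * ghostPath K β ∈ S)
    (x : LeavittPathAlgebra E K) : x ∈ S :=
  iSup_le (fun _ => component_le fun α β _ => h α β) (mem_iSup_component x)

end Paths

end LeavittPathAlgebra

namespace LeavittPathAlgebra

/-! ### Local units -/

section LocalUnits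

variable {V : Type*} {Edge : Type*} {E : DirectedGraph V Edge} {K : Type*} [Field K]

/-- A monomial α β* is fixed on the right by s(β) and killed by every other vertex. Allowing all
larger G lets the finite sets of two summands be merged. -/
theorem exists_mul_sum_vertex_eq (x : LeavittPathAlgebra E K) :
    ∃ F : Finset V, ∀ G, F ⊆ G → x * ∑ v ∈ G, vertex E K v = x := by
  classical
  let S : Submodule K (LeavittPathAlgebra E K) :=
    { carrier := {x | ∃ F : Finset V, ∀ G, F ⊆ G → x * ∑ v ∈ G, vertex E K v = x}
      zero_mem' := ⟨∅, fun _ _ => zero_mul _⟩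
      add_mem' := by
        rintro x y ⟨F, hF⟩ ⟨F', hF'⟩
        refine ⟨F ∪ F', fun G hG => ?_⟩
        rw [add_mul, hF G (Finset.union_subset_left hG), hF' G (Finset.union_subset_right hG)]
      smul_mem' := by
        rintro k x ⟨F, hF⟩
        exact ⟨F, fun G hG => by rw [smul_mul_assoc, hF G hG]⟩ }
  refine mem_of_monomial_mem (S := S) (fun {a b c} α β => ⟨{c}, fun G hG => ?_⟩) x
  rw [mul_assoc, Finset.mul_sum, Finset.sum_eq_single_of_mem c (hG (by simp)),
    ghostPath_mul_source]
  exact fun v _ hv => ghostPath_mul_vertex_of_ne K β hv.symm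

theorem exists_sum_vertex_mul_eq (x : LeavittPathAlgebra E K) :
    ∃ F : Finset V, ∀ G, F ⊆ G → (∑ v ∈ G, vertex E K v) * x = x := by
  classical
  let S : Submodule K (LeavittPathAlgebra E K) :=
    { carrier := {x | ∃ F : Finset V, ∀ G, F ⊆ G → (∑ v ∈ G, vertex E K v) * x = x}
      zero_mem' := ⟨∅, fun _ _ => mul_zero _⟩
      add_mem' := by
        rintro x y ⟨F, hF⟩ ⟨F', hF'⟩
        refine ⟨F ∪ F', fun G hG => ?_⟩
        rw [mul_add, hF G (Finset.union_subset_left hG), hF' G (Finset.union_subset_right hG)]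
      smul_mem' := by
        rintro k x ⟨F, hF⟩
        exact ⟨F, fun G hG => by rw [mul_smul_comm, hF G hG]⟩ }
  refine mem_of_monomial_mem (S := S) (fun {a b c} α β => ⟨{a}, fun G hG => ?_⟩) x
  rw [← mul_assoc, Finset.sum_mul, Finset.sum_eq_single_of_mem a (hG (by simp)),
    source_mul_path]
  exact fun v _ hv => vertex_mul_path_of_ne K α hv

/-- Since x is a finite sum of elements x v, membership in an ideal can be tested one vertex at a
time; the relation v = ∑ e e* can then be used at each v. -/
theorem mem_of_mul_vertex_mem {I : TwoSidedIdeal (LeavittPathAlgebra E K)}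
    {x : LeavittPathAlgebra E K} (h : ∀ v, x * vertex E K v ∈ I) : x ∈ I := by
  obtain ⟨F, hF⟩ := exists_mul_sum_vertex_eq x
  rw [← hF F subset_rfl, Finset.mul_sum]
  exact sum_mem fun v _ => h v

theorem mem_of_vertex_mul_mem {I : TwoSidedIdeal (LeavittPathAlgebra E K)}
    {x : LeavittPathAlgebra E K} (h : ∀ v, vertex E K v * x ∈ I) : x ∈ I := by
  obtain ⟨F, hF⟩ := exists_sum_vertex_mul_eq x
  rw [← hF F subset_rfl, Finset.sum_mul]
  exact sum_mem fun v _ => h v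

theorem eq_zero_of_mul_eq_zero {x : LeavittPathAlgebra E K} (h : ∀ y, x * y = 0) : x = 0 := by
  obtain ⟨F, hF⟩ := exists_mul_sum_vertex_eq x
  rw [← hF F subset_rfl, h]

/-- A ring ideal of a non-unital algebra need not be a subspace; here local units help, because (k
x) v = x (k v). -/
theorem smul_mem_twoSidedIdeal {I : TwoSidedIdeal (LeavittPathAlgebra E K)}
    (k : K) {x : LeavittPathAlgebra E K} (hx : x ∈ I) : k • x ∈ I := by
  refine mem_of_mul_vertex_mem fun v => ?_
  rw [smul_mul_assoc, ← mul_smul_comm]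
  exact I.mul_mem_right _ _ hx

end LocalUnits

/-! ### A representation in which no vertex vanishes -/

section VertexNeZero

variable {V : Type*} {Edge : Type*} {E : DirectedGraph V Edge}

/-- Injections of `ℕ` indexed by the edges, such that the images belonging to the edges emitted
by a given vertex partition `ℕ`. -/
theorem exists_edge_partition (hE : E.RowFinite) :
    ∃ θ : Edge → ℕ → ℕ,
      (∀ e f m n, E.s e = E.s f → θ e m = θ f n → e = f ∧ m = n) ∧
        ∀ e m, ∃ f n, E.s f = E.s e ∧ θ f n = m := by
  have h (v : V) : ∃ σ : {e // E.s e = v} × ℕ → ℕ,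
      Function.Injective σ ∧ (Nonempty {e // E.s e = v} → Function.Surjective σ) := by
    have : Finite {e // E.s e = v} := hE v
    cases isEmpty_or_nonempty {e // E.s e = v} with
    | inl he => exact ⟨fun x => x.2, fun x => he.elim x.1, fun hn => isEmptyElim hn.some⟩
    | inr _ =>
      obtain ⟨σ⟩ := nonempty_equiv_of_countable (α := {e // E.s e = v} × ℕ) (β := ℕ)
      exact ⟨σ, σ.injective, fun _ => σ.surjective⟩
  choose σ hi hs using h
  refine ⟨fun e n => σ (E.s e) (⟨e, rfl⟩, n), fun e f m n hef h => ?_, fun e m => ?_⟩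
  · have hf : σ (E.s f) (⟨f, rfl⟩, n) = σ (E.s e) (⟨f, hef.symm⟩, n) := by
      clear h; revert hef; generalize E.s e = v; rintro rfl; rfl
    have := hi _ (h.trans hf)
    simpa using this
  · obtain ⟨⟨⟨f, hf⟩, n⟩, h⟩ := hs (E.s e) ⟨⟨e, rfl⟩⟩ m
    refine ⟨f, n, hf, ?_⟩
    rw [← h]
    clear h; revert hf; generalize E.s e = v; rintro rfl; rfl

variable (K : Type*) [Field K]

/-- The partial isometry of `X → K` attached to two maps into `X`. -/
noncomputable def transport {X : Type*} (i j : ℕ → X) : Module.End K (X → K) :=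
  Function.ExtendByZero.linearMap K i ∘ₗ LinearMap.funLeft K K j

variable {K}

theorem transport_apply {X : Type*} {i : ℕ → X} (hi : i.Injective) (j : ℕ → X) (f : X → K)
    (n : ℕ) : transport K i j f (i n) = f (j n) :=
  hi.extend_apply _ _ n

theorem transport_apply_of_notMem {X : Type*} {i : ℕ → X} (j : ℕ → X) (f : X → K) {x : X}
    (hx : x ∉ Set.range i) : transport K i j f x = 0 :=
  Function.extend_apply' _ _ _ hx

theorem transport_mul_transport {X : Type*} {i j : ℕ → X} (hi : i.Injective)
    (hj : j.Injective) (l : ℕ → X) :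
    transport K i j * transport K j l = transport K i l := by
  ext1 f
  funext x
  rw [Module.End.mul_apply]
  by_cases hx : x ∈ Set.range i
  · obtain ⟨n, rfl⟩ := hx
    rw [transport_apply hi, transport_apply hi, transport_apply hj]
  · rw [transport_apply_of_notMem _ _ hx, transport_apply_of_notMem _ _ hx]

theorem transport_mul_transport_of_disjoint {X : Type*} {i j k l : ℕ → X} (hi : i.Injective)
    (h : ∀ n, j n ∉ Set.range k) : transport K i j * transport K k l = 0 := by
  ext1 f
  funext x
  rw [Module.End.mul_apply, LinearMap.zero_apply, Pi.zero_apply]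
  by_cases hx : x ∈ Set.range i
  · obtain ⟨n, rfl⟩ := hx
    rw [transport_apply hi, transport_apply_of_notMem _ _ (h n)]
  · rw [transport_apply_of_notMem _ _ hx]

variable (K) in
open Classical in
/-- The projection of `V × ℕ → K` onto the functions supported on `{a} × ℕ`. -/
noncomputable def fiberProj (a : V) : Module.End K (V × ℕ → K) where
  toFun f x := if x.1 = a then f x else 0
  map_add' f g := by ext x; by_cases h : x.1 = a <;> simp [h]
  map_smul' k f := by ext x; by_cases h : x.1 = a <;> simp [h]

open Classical in
theorem fiberProj_apply (a : V) (f : V × ℕ → K) (x : V × ℕ) :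
    fiberProj K a f x = if x.1 = a then f x else 0 := rfl

theorem fiberProj_mul_transport {a : V} {i : ℕ → V × ℕ} (h : ∀ n, (i n).1 = a)
    (j : ℕ → V × ℕ) : fiberProj K a * transport K i j = transport K i j := by
  ext1 f
  funext x
  rw [Module.End.mul_apply, fiberProj_apply]
  split_ifs with hx
  · rfl
  · refine (transport_apply_of_notMem _ _ ?_).symm
    rintro ⟨n, rfl⟩
    exact hx (h n)

theorem transport_mul_fiberProj {a : V} {i : ℕ → V × ℕ} (hi : i.Injective) {j : ℕ → V × ℕ}
    (h : ∀ n, (j n).1 = a) : transport K i j * fiberProj K a = transport K i j := by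
  ext1 f
  funext x
  rw [Module.End.mul_apply]
  by_cases hx : x ∈ Set.range i
  · obtain ⟨n, rfl⟩ := hx
    rw [transport_apply hi, transport_apply hi, fiberProj_apply, if_pos (h n)]
  · rw [transport_apply_of_notMem _ _ hx, transport_apply_of_notMem _ _ hx]

theorem transport_eq_fiberProj (a : V) :
    transport K (Prod.mk a) (Prod.mk a) = fiberProj K a := by
  ext1 f
  funext x
  rw [fiberProj_apply]
  split_ifs with hx
  · obtain ⟨b, n⟩ := x
    obtain rfl : b = a := hx
    exact transport_apply (Prod.mk_right_injective b) _ f n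
  · refine transport_apply_of_notMem _ _ ?_
    rintro ⟨n, rfl⟩
    exact hx rfl

variable (K) in
/-- Vertices are nonzero in the Leavitt path algebra of a row-finite graph. -/
theorem vertex_ne_zero (hE : E.RowFinite) (v : V) : vertex E K v ≠ 0 := by
  obtain ⟨θ, hinj, hsurj⟩ := exists_edge_partition hE
  let j : Edge → ℕ → V × ℕ := fun e n => (E.s e, θ e n)
  have hj : ∀ e, (j e).Injective := fun e m n h => (hinj e e m n rfl (congrArg Prod.snd h)).2
  have hι : ∀ a : V, (Prod.mk a : ℕ → V × ℕ).Injective := fun a => Prod.mk_right_injective a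
  have fam : IsLeavittFamily E (fiberProj K)
      (fun e => transport K (j e) (Prod.mk (E.r e)))
      (fun e => transport K (Prod.mk (E.r e)) (j e)) := by
    constructor
    · intro a
      ext1 f; funext x
      rw [Module.End.mul_apply, fiberProj_apply, fiberProj_apply]
      split_ifs <;> rfl
    · intro a b hab
      ext1 f; funext x
      rw [Module.End.mul_apply, fiberProj_apply, fiberProj_apply]
      split_ifs with h₁ h₂
      · exact absurd (h₁.symm.trans h₂) hab
      · rfl
      · rfl
    · exact fun e => fiberProj_mul_transport (fun n => by rfl) _
    · exact fun e => transport_mul_fiberProj (hj e) fun _ => rfl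
    · exact fun e => fiberProj_mul_transport (fun n => by rfl) _
    · exact fun e => transport_mul_fiberProj (hι _) fun _ => rfl
    · exact fun e => (transport_mul_transport (hι _) (hj e) _).trans (transport_eq_fiberProj _)
    · intro e f hef
      refine transport_mul_transport_of_disjoint (hι _) ?_
      rintro m ⟨n, h⟩
      exact hef (hinj f e n m (congrArg Prod.fst h) (congrArg Prod.snd h)).1.symm
    · intro a F hF hne
      obtain ⟨e₀, he₀⟩ := hne
      ext1 f; funext x
      simp only [transport_mul_transport (hj _) (hι _), LinearMap.sum_apply, Finset.sum_apply]
      rw [fiberProj_apply]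
      split_ifs with hx
      · obtain ⟨b, m⟩ := x
        obtain rfl : b = a := hx
        -- Each e e* acts as the projection onto the piece of the fibre belonging to e. The pieces
        -- partition the fibre, so exactly one summand survives at the given point.
        obtain ⟨e, n, he, rfl⟩ := hsurj e₀ m
        obtain rfl : E.s e = b := he.trans ((hF e₀).1 he₀)
        rw [Finset.sum_eq_single_of_mem e ((hF e).2 rfl)]
        · exact (transport_apply (hj e) (j e) f n).symm
        · intro e' _ hne
          refine transport_apply_of_notMem _ _ ?_
          rintro ⟨n', h⟩
          exact hne (hinj e' e n' n (congrArg Prod.fst h) (congrArg Prod.snd h)).1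
      · refine (Finset.sum_eq_zero fun e he => transport_apply_of_notMem _ _ ?_).symm
        rintro ⟨n, rfl⟩
        exact hx ((hF e).1 he)
  obtain ⟨φ, hφ, -, -⟩ := exists_lift (K := K) fam
  intro h
  -- The projection at v fixes the value of the constant function 1 at (v, 0), whereas a zero vertex
  -- would act as zero.
  have h₁ : fiberProj K v (fun _ => 1) (v, 0) = 0 := by
    rw [← hφ, h, map_zero]; rfl
  rw [fiberProj_apply, if_pos rfl] at h₁
  exact one_ne_zero h₁

end VertexNeZero
end LeavittPathAlgebra

namespace LeavittPathAlgebra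

/-! ### Separating degrees with Laurent polynomials -/

section Grading

variable {V : Type*} {Edge : Type*} {E : DirectedGraph V Edge} {K : Type*} [Field K]

/-- The endomorphism `y tᵐ ↦ x y tᵐ⁺ⁿ` of the Laurent polynomials over `L_K(E)`. -/
noncomputable def shiftMul (n : ℤ) (x : LeavittPathAlgebra E K) :
    Module.End K (ℤ →₀ LeavittPathAlgebra E K) :=
  Finsupp.lmapDomain _ K (n + ·) ∘ₗ Finsupp.mapRange.linearMap (LinearMap.mulLeft K x)

theorem shiftMul_single (n m : ℤ) (x y : LeavittPathAlgebra E K) :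
    shiftMul n x (Finsupp.single m y) = Finsupp.single (n + m) (x * y) := by
  rw [shiftMul, LinearMap.comp_apply, Finsupp.mapRange.linearMap_apply, Finsupp.mapRange_single,
    Finsupp.lmapDomain_apply, Finsupp.mapDomain_single, LinearMap.mulLeft_apply]

theorem shiftMul_mul (n m : ℤ) (x y : LeavittPathAlgebra E K) :
    shiftMul n x * shiftMul m y = shiftMul (n + m) (x * y) := by
  refine Finsupp.lhom_ext fun k z => ?_
  rw [Module.End.mul_apply, shiftMul_single, shiftMul_single, shiftMul_single, mul_assoc,
    add_assoc]

/-- `shiftMul` as a linear map in the second argument. -/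
noncomputable def shiftMulHom (n : ℤ) :
    LeavittPathAlgebra E K →ₗ[K] Module.End K (ℤ →₀ LeavittPathAlgebra E K) where
  toFun := shiftMul n
  map_add' x y := Finsupp.lhom_ext fun k z => by
    rw [LinearMap.add_apply, shiftMul_single, shiftMul_single, shiftMul_single, add_mul,
      Finsupp.single_add]
  map_smul' c x := Finsupp.lhom_ext fun k z => by
    rw [RingHom.id_apply, LinearMap.smul_apply, shiftMul_single, shiftMul_single, smul_mul_assoc,
      Finsupp.smul_single]

theorem shiftMulHom_apply (n : ℤ) (x : LeavittPathAlgebra E K) :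
    shiftMulHom n x = shiftMul n x := rfl

variable (E K)

/-- The grading of `L_K(E)`, as an action on Laurent polynomials. -/
theorem exists_grading_hom :
    ∃ φ : LeavittPathAlgebra E K →ₙₐ[K] Module.End K (ℤ →₀ LeavittPathAlgebra E K),
      ∀ n, ∀ x ∈ component E K n, φ x = shiftMul n x := by
  have fam : IsLeavittFamily E (fun a => shiftMul 0 (vertex E K a))
      (fun e => shiftMul 1 (edge E K e)) (fun e => shiftMul (-1) (ghost E K e)) := by
    have zero (n : ℤ) : shiftMul n (0 : LeavittPathAlgebra E K) = 0 := map_zero (shiftMulHom n)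
    constructor
    · intro a; simp [shiftMul_mul]
    · intro a b h; simp [shiftMul_mul, vertex_mul_vertex_of_ne E K h, zero]
    · intro e; simp [shiftMul_mul]
    · intro e; simp [shiftMul_mul]
    · intro e; simp [shiftMul_mul]
    · intro e; simp [shiftMul_mul]
    · intro e; simp [shiftMul_mul]
    · intro e f h; simp [shiftMul_mul, ghost_mul_edge_of_ne E K h, zero]
    · intro a F hF hne
      rw [vertex_eq_sum E K a F hF hne, ← shiftMulHom_apply, map_sum]
      exact Finset.sum_congr rfl fun e _ => by
        rw [shiftMul_mul, add_neg_cancel, shiftMulHom_apply]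
  obtain ⟨φ, hv, he, hg⟩ := exists_lift (K := K) fam
  have hpath {a b : V} (α : E.Path a b) : φ (path K α) = shiftMul α.length (path K α) := by
    induction α with
    | nil => exact hv _
    | cons e h p ih =>
      rw [path, map_mul, he, ih, shiftMul_mul, DirectedGraph.Path.length]
      push_cast
      rw [add_comm]
  have hghost {a b : V} (α : E.Path a b) :
      φ (ghostPath K α) = shiftMul (-α.length) (ghostPath K α) := by
    induction α with
    | nil => exact hv _
    | cons e h p ih =>
      rw [ghostPath, map_mul, hg, ih, shiftMul_mul, DirectedGraph.Path.length]
      push_cast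
      rw [neg_add]
  refine ⟨φ, fun n x hx => ?_⟩
  refine component_le (S := LinearMap.eqLocus (φ : _ →ₗ[K] _) (shiftMulHom n))
    (fun α β hl => ?_) hx
  change φ _ = shiftMul n _
  rw [map_mul, hpath, hghost, shiftMul_mul, ← sub_eq_add_neg, hl]

variable {E K}

/-- If a sum of homogeneous elements of distinct degrees vanishes after left multiplication by a
homogeneous element, so does every summand. -/
theorem mul_eq_zero_of_mul_sum_eq_zero {m : ℤ} {x : LeavittPathAlgebra E K}
    (hx : x ∈ component E K m) (y : ℤ →₀ LeavittPathAlgebra E K)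
    (hy : ∀ n, y n ∈ component E K n) (h : x * y.sum (fun _ z => z) = 0) (n : ℤ) :
    x * y n = 0 := by
  obtain ⟨φ, hφ⟩ := exists_grading_hom E K
  refine eq_zero_of_mul_eq_zero fun z => ?_
  -- Acting on z t⁰ and reading off the coefficient of t^(m+n) isolates x yₙ z. An arbitrary z
  -- stands in for the missing unit.
  have h₁ := congrArg (fun T => φ T (Finsupp.single 0 z) (m + n)) h
  simp only [map_mul, Finsupp.sum, map_sum, map_zero, hφ m x hx, hφ _ _ (hy _),
    Module.End.mul_apply, LinearMap.sum_apply, shiftMul_single, LinearMap.zero_apply,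
    Finsupp.finsetSum_apply, Finsupp.zero_apply, Finsupp.single_apply] at h₁
  rw [mul_assoc]
  by_cases hn : y n = 0
  · rw [hn, zero_mul, mul_zero]
  · rw [Finset.sum_eq_single_of_mem n (by simpa using hn)] at h₁
    · simpa using h₁
    · intro k _ hk
      rw [if_neg (by omega)]

theorem mul_eq_zero_of_sum_mul_eq_zero {m : ℤ} {x : LeavittPathAlgebra E K}
    (hx : x ∈ component E K m) (y : ℤ →₀ LeavittPathAlgebra E K)
    (hy : ∀ n, y n ∈ component E K n) (h : y.sum (fun _ z => z) * x = 0) (n : ℤ) :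
    y n * x = 0 := by
  obtain ⟨φ, hφ⟩ := exists_grading_hom E K
  refine eq_zero_of_mul_eq_zero fun z => ?_
  have h₁ := congrArg (fun T => φ T (Finsupp.single 0 z) (n + m)) h
  simp only [map_mul, Finsupp.sum, map_sum, map_zero, hφ m x hx, hφ _ _ (hy _),
    Module.End.mul_apply, LinearMap.sum_apply, shiftMul_single, LinearMap.zero_apply,
    Finsupp.finsetSum_apply, Finsupp.zero_apply, Finsupp.single_apply] at h₁
  rw [mul_assoc]
  by_cases hn : y n = 0
  · rw [hn, zero_mul]
  · rw [Finset.sum_eq_single_of_mem n (by simpa using hn)] at h₁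
    · simpa using h₁
    · intro k _ hk
      rw [if_neg (by omega)]

theorem exists_homogeneous_decomposition (x : LeavittPathAlgebra E K) :
    ∃ y : ℤ →₀ LeavittPathAlgebra E K,
      (∀ n, y n ∈ component E K n) ∧ x = y.sum fun _ z => z := by
  obtain ⟨y, hy, h⟩ := (Submodule.mem_iSup_iff_exists_finsupp _ _).1 (mem_iSup_component x)
  exact ⟨y, hy, h.symm⟩

end Grading

end LeavittPathAlgebra

/-! ### Annihilators as two-sided ideals -/

section Perp

variable {A : Type*} [NonUnitalRing A]

/-- The annihilator of a two-sided ideal, as a two-sided ideal. -/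
noncomputable def TwoSidedIdeal.perpIdeal (J : TwoSidedIdeal A) : TwoSidedIdeal A :=
  .mk' (perp (J : Set A)) (fun x _ => ⟨zero_mul x, mul_zero x⟩)
    (fun ha hb x hx => ⟨by rw [add_mul, (ha x hx).1, (hb x hx).1, add_zero],
      by rw [mul_add, (ha x hx).2, (hb x hx).2, add_zero]⟩)
    (fun ha x hx => ⟨by rw [neg_mul, (ha x hx).1, neg_zero],
      by rw [mul_neg, (ha x hx).2, neg_zero]⟩)
    (fun {a b} hb x hx => ⟨by rw [mul_assoc, (hb x hx).1, mul_zero],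
      by rw [← mul_assoc, (hb _ (J.mul_mem_right x a hx)).2]⟩)
    (fun {a b} ha x hx => ⟨by rw [mul_assoc, (ha _ (J.mul_mem_left b x hx)).1],
      by rw [← mul_assoc, (ha x hx).2, zero_mul]⟩)

theorem TwoSidedIdeal.coe_perpIdeal (J : TwoSidedIdeal A) :
    (J.perpIdeal : Set A) = perp (J : Set A) :=
  TwoSidedIdeal.coe_mk' ..

theorem TwoSidedIdeal.mem_perpIdeal {J : TwoSidedIdeal A} {a : A} :
    a ∈ J.perpIdeal ↔ ∀ x ∈ J, a * x = 0 ∧ x * a = 0 :=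
  TwoSidedIdeal.mem_mk' ..

end Perp

namespace LeavittPathAlgebra

/-! ### Graded ideals, their annihilators and their vertices -/

section GradedIdeals

variable {V : Type*} {Edge : Type*} {E : DirectedGraph V Edge} {K : Type*} [Field K]

theorem vertex_mem_of_path {J : TwoSidedIdeal (LeavittPathAlgebra E K)} {a b : V}
    (α : E.Path a b) (ha : vertex E K a ∈ J) : vertex E K b ∈ J := by
  rw [← ghostPath_mul_path_self K α, ← source_mul_path K α]
  exact J.mul_mem_left _ _ (J.mul_mem_right _ _ ha)

theorem vertex_mem_idealOf {H : Set V} {a : V} (h : a ∈ H) : vertex E K a ∈ idealOf E K H :=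
  TwoSidedIdeal.subset_span ⟨a, h, rfl⟩

variable (E K)

/-- The span of the paths of length `m`. -/
noncomputable def pathSpan (m : ℕ) : Submodule K (LeavittPathAlgebra E K) :=
  Submodule.span K {x | ∃ (a b : V) (α : E.Path a b), α.length = m ∧ x = path K α}

/-- The span of the monomials `α β*` with `|α| - |β| = n` and `|β| ≤ N`. -/
noncomputable def monomialSpan (n : ℤ) (N : ℕ) : Submodule K (LeavittPathAlgebra E K) :=
  Submodule.span K {x | ∃ (a b c : V) (α : E.Path a b) (β : E.Path c b),
    (α.length : ℤ) - β.length = n ∧ β.length ≤ N ∧ x = path K α * ghostPath K β}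

variable {E K}

theorem pathSpan_le {m : ℕ} {S : Submodule K (LeavittPathAlgebra E K)}
    (h : ∀ {a b} (α : E.Path a b), α.length = m → path K α ∈ S) : pathSpan E K m ≤ S := by
  refine Submodule.span_le.2 ?_
  rintro _ ⟨a, b, α, hl, rfl⟩
  exact h α hl

theorem monomialSpan_le {n : ℤ} {N : ℕ} {S : Submodule K (LeavittPathAlgebra E K)}
    (h : ∀ {a b c} (α : E.Path a b) (β : E.Path c b), (α.length : ℤ) - β.length = n →
      β.length ≤ N → path K α * ghostPath K β ∈ S) : monomialSpan E K n N ≤ S := by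
  refine Submodule.span_le.2 ?_
  rintro _ ⟨a, b, c, α, β, hl, hN, rfl⟩
  exact h α β hl hN

/-- Without ghost edges the degree is the path length. For n < 0 there are no such monomials, so the
value of `n.toNat` is harmless. -/
theorem monomialSpan_zero_le (n : ℤ) : monomialSpan E K n 0 ≤ pathSpan E K n.toNat := by
  refine monomialSpan_le fun {a b c} α β hl hN => ?_
  cases β with
  | nil =>
    rw [ghostPath, path_mul_range]
    exact Submodule.subset_span ⟨_, _, α, by simp [DirectedGraph.Path.length] at hl; omega, rfl⟩
  | cons e h p => simp [DirectedGraph.Path.length] at hN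

theorem exists_mem_monomialSpan {n : ℤ} {x : LeavittPathAlgebra E K}
    (hx : x ∈ component E K n) : ∃ N, x ∈ monomialSpan E K n N := by
  have hmono : Monotone (monomialSpan E K n) := fun N N' h =>
    monomialSpan_le fun α β hl hN =>
      Submodule.subset_span ⟨_, _, _, α, β, hl, hN.trans h, rfl⟩
  rw [← Submodule.mem_iSup_of_directed _ hmono.directed_le]
  refine component_le (fun α β hl => ?_) hx
  exact Submodule.mem_iSup_of_mem β.length
    (Submodule.subset_span ⟨_, _, _, α, β, hl, le_rfl, rfl⟩)

/-- Induction on the path length m: v x = ∑ e (e* x), and each e* x lies in J and involves only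
paths one edge shorter. At length 0, v x is a multiple of v. -/
theorem mem_idealOf_of_mem_pathSpan (hE : E.RowFinite)
    {J : TwoSidedIdeal (LeavittPathAlgebra E K)} {m : ℕ} {x : LeavittPathAlgebra E K}
    (hxJ : x ∈ J) (hx : x ∈ pathSpan E K m) : x ∈ idealOf E K (vertexSet J) := by
  induction m generalizing x with
  | zero =>
    refine mem_of_vertex_mul_mem fun v => ?_
    have hv : vertex E K v * x ∈ Submodule.span K {vertex E K v} := by
      refine pathSpan_le (S := (Submodule.span K {vertex E K v}).comap
        (LinearMap.mulLeft K (vertex E K v))) (fun {a b} α hl => ?_) hx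
      rw [Submodule.mem_comap, LinearMap.mulLeft_apply]
      cases α with
      | nil =>
        rw [path]
        by_cases h : v = a
        · subst h; rw [vertex_mul_self]; exact Submodule.mem_span_singleton_self _
        · rw [vertex_mul_vertex_of_ne E K h]; exact zero_mem _
      | cons e h p => simp [DirectedGraph.Path.length] at hl
    obtain ⟨k, hk⟩ := Submodule.mem_span_singleton.1 hv
    -- If v x = k v with k ≠ 0, dividing by k puts v in J, hence in H(J).
    by_cases hk₀ : k = 0
    · rw [← hk, hk₀, zero_smul]; exact zero_mem _
    · have hvJ : vertex E K v ∈ J := by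
        have := smul_mem_twoSidedIdeal k⁻¹ (J.mul_mem_left (vertex E K v) x hxJ)
        rwa [← hk, inv_smul_smul₀ hk₀] at this
      exact TwoSidedIdeal.mul_mem_right _ _ _ (vertex_mem_idealOf hvJ)
  | succ m ih =>
    refine mem_of_vertex_mul_mem fun v => ?_
    rcases sink_or_vertex_eq_sum E K hE v with hv | ⟨F, hF⟩
    · have : vertex E K v * x = 0 := by
        refine pathSpan_le (S := (LinearMap.mulLeft K (vertex E K v)).ker)
          (fun {a b} α hl => ?_) hx
        rw [LinearMap.mem_ker, LinearMap.mulLeft_apply]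
        cases α with
        | nil => simp [DirectedGraph.Path.length] at hl
        | cons e h p => exact vertex_mul_path_of_ne K _ fun hva => hv e (h.trans hva.symm)
      rw [this]
      exact zero_mem _
    · rw [hF, Finset.sum_mul]
      refine sum_mem fun e _ => ?_
      rw [mul_assoc]
      refine TwoSidedIdeal.mul_mem_left _ _ _ (ih (J.mul_mem_left _ _ hxJ) ?_)
      refine pathSpan_le (S := (pathSpan E K m).comap (LinearMap.mulLeft K (ghost E K e)))
        (fun {a b} α hl => ?_) hx
      rw [Submodule.mem_comap, LinearMap.mulLeft_apply]
      cases α with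
      | nil => simp [DirectedGraph.Path.length] at hl
      | cons f h p =>
        rw [path, ← mul_assoc]
        by_cases hef : e = f
        · subst hef
          rw [ghost_mul_edge_self, source_mul_path]
          exact Submodule.subset_span
            ⟨_, _, p, by simpa [DirectedGraph.Path.length] using hl, rfl⟩
        · rw [ghost_mul_edge_of_ne E K hef, zero_mul]
          exact zero_mem _

/-- Ghost edges are removed from the right: x v = ∑ (x e) e*, and x e has degree n + 1 and ghost
parts one edge shorter, or still trivial. Hence n varies in the induction on N. If v is a sink, the
only ghost path surviving in x v is trivial. -/
theorem mem_idealOf_of_mem_monomialSpan (hE : E.RowFinite)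
    {J : TwoSidedIdeal (LeavittPathAlgebra E K)} {n : ℤ} {N : ℕ} {x : LeavittPathAlgebra E K}
    (hxJ : x ∈ J) (hx : x ∈ monomialSpan E K n N) : x ∈ idealOf E K (vertexSet J) := by
  induction N generalizing n x with
  | zero => exact mem_idealOf_of_mem_pathSpan hE hxJ (monomialSpan_zero_le n hx)
  | succ N ih =>
    refine mem_of_mul_vertex_mem fun v => ?_
    rcases sink_or_vertex_eq_sum E K hE v with hv | ⟨F, hF⟩
    · refine ih (n := n) (J.mul_mem_right _ _ hxJ) ?_
      refine monomialSpan_le (S := (monomialSpan E K n N).comap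
        (LinearMap.mulRight K (vertex E K v))) (fun {a b c} α β hl hN => ?_) hx
      rw [Submodule.mem_comap, LinearMap.mulRight_apply, mul_assoc]
      by_cases h : c = v
      · subst h
        rw [ghostPath_mul_source]
        cases β with
        | nil => exact Submodule.subset_span ⟨_, _, _, α, .nil _, hl, Nat.zero_le _, rfl⟩
        | cons e h p => exact absurd h (hv e)
      · rw [ghostPath_mul_vertex_of_ne K β h, mul_zero]
        exact zero_mem _
    · rw [hF, Finset.mul_sum]
      refine sum_mem fun e _ => ?_
      rw [← mul_assoc]
      refine TwoSidedIdeal.mul_mem_right _ _ _ (ih (n := n + 1) (J.mul_mem_right _ _ hxJ) ?_)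
      refine monomialSpan_le (S := (monomialSpan E K (n + 1) N).comap
        (LinearMap.mulRight K (edge E K e))) (fun {a b c} α β hl hN => ?_) hx
      rw [Submodule.mem_comap, LinearMap.mulRight_apply, mul_assoc]
      cases β with
      | nil =>
        rw [ghostPath, ← mul_assoc, path_mul_range]
        by_cases h : E.s e = b
        · obtain ⟨γ, hγ, hp, -⟩ := exists_path_snoc K α e h
          refine Submodule.subset_span ⟨_, _, _, γ, .nil _, ?_, Nat.zero_le _, ?_⟩
          · simp [DirectedGraph.Path.length] at hl ⊢; omega
          · rw [ghostPath, path_mul_range, hp]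
        · rw [← path_mul_range, mul_assoc, vertex_mul_edge_of_ne E K (Ne.symm h), mul_zero]
          exact zero_mem _
      | cons f h p =>
        rw [ghostPath, mul_assoc]
        by_cases hef : f = e
        · subst hef
          rw [ghost_mul_edge_self, ghostPath_mul_source]
          refine Submodule.subset_span ⟨_, _, _, α, p, ?_, ?_, rfl⟩
          · simp [DirectedGraph.Path.length] at hl ⊢; omega
          · simpa [DirectedGraph.Path.length] using hN
        · rw [ghost_mul_edge_of_ne E K hef, mul_zero, mul_zero]
          exact zero_mem _

/-- In a row-finite graph, a graded ideal is generated by the vertices it contains. -/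
theorem IsGraded.eq_idealOf (hE : E.RowFinite) {J : TwoSidedIdeal (LeavittPathAlgebra E K)}
    (hJ : IsGraded J) : J = idealOf E K (vertexSet J) := by
  refine le_antisymm (fun x hx => ?_) (TwoSidedIdeal.span_le.2 ?_)
  · obtain ⟨y, hy, rfl⟩ := hJ x hx
    refine sum_mem fun n _ => ?_
    obtain ⟨N, hN⟩ := exists_mem_monomialSpan (hy n).2
    exact mem_idealOf_of_mem_monomialSpan hE (hy n).1 hN
  · rintro _ ⟨a, ha, rfl⟩
    exact ha

/-- Split a ∈ J^⊥ and x ∈ J into homogeneous parts, those of x lying in J because J is graded. From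
a zₘ = 0, comparing degrees gives yₙ zₘ = 0 for every n, and likewise on the other side. -/
theorem IsGraded.perpIdeal {J : TwoSidedIdeal (LeavittPathAlgebra E K)}
    (hJ : IsGraded J) : IsGraded J.perpIdeal := by
  intro a ha
  obtain ⟨y, hy, rfl⟩ := exists_homogeneous_decomposition a
  refine ⟨y, fun n => ⟨TwoSidedIdeal.mem_perpIdeal.2 fun x hx => ?_, hy n⟩, rfl⟩
  obtain ⟨z, hz, rfl⟩ := hJ x hx
  constructor
  · rw [Finsupp.sum, Finset.mul_sum]
    exact Finset.sum_eq_zero fun m _ => mul_eq_zero_of_sum_mul_eq_zero (hz m).2 y hy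
      (TwoSidedIdeal.mem_perpIdeal.1 ha _ (hz m).1).1 n
  · rw [Finsupp.sum, Finset.sum_mul]
    exact Finset.sum_eq_zero fun m _ => mul_eq_zero_of_mul_sum_eq_zero (hz m).2 y hy
      (TwoSidedIdeal.mem_perpIdeal.1 ha _ (hz m).1).2 n

/-- If no vertex is reachable from both `u` and `v`, then `u L_K(E) v = 0`. -/
theorem vertex_mul_mul_vertex_eq_zero {u v : V} (h : Disjoint (E.tree u) (E.tree v))
    (x : LeavittPathAlgebra E K) : vertex E K u * x * vertex E K v = 0 := by
  refine mem_of_monomial_mem (S := (LinearMap.mulRight K (vertex E K v) ∘ₗ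
    LinearMap.mulLeft K (vertex E K u)).ker) (fun {a b c} α β => ?_) x
  rw [LinearMap.mem_ker, LinearMap.comp_apply, LinearMap.mulRight_apply, LinearMap.mulLeft_apply]
  by_cases hu : u = a
  · by_cases hv : c = v
    · subst hu hv
      exact (Set.disjoint_left.1 h ⟨α⟩ ⟨β⟩).elim
    · rw [mul_assoc, mul_assoc, ghostPath_mul_vertex_of_ne K β hv, mul_zero, mul_zero]
  · rw [← mul_assoc, vertex_mul_path_of_ne K α hu, zero_mul, zero_mul]

theorem vertex_mem_perpIdeal_idealOf {H : Set V} {w : V}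
    (hw : ∀ h ∈ H, Disjoint (E.tree w) (E.tree h)) :
    vertex E K w ∈ (idealOf E K H).perpIdeal := by
  rw [TwoSidedIdeal.mem_perpIdeal]
  -- The arbitrary middle factor y makes the statement stable under multiplying x by ring elements
  -- on either side; y = w recovers the claim.
  have key : ∀ x ∈ idealOf E K H, ∀ y, vertex E K w * y * x = 0 ∧ x * y * vertex E K w = 0 := by
    intro x hx
    induction hx using TwoSidedIdeal.span_induction with
    | mem x hx =>
      obtain ⟨h, hh, rfl⟩ := hx
      exact fun y => ⟨vertex_mul_mul_vertex_eq_zero (hw h hh) y,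
        vertex_mul_mul_vertex_eq_zero (hw h hh).symm y⟩
    | zero => simp
    | add x z _ _ hx hz => exact fun y => by simp [mul_add, add_mul, hx y, hz y]
    | neg x _ hx => exact fun y => by simp [hx y]
    | left_absorb a x _ hx =>
      exact fun y => ⟨by rw [← mul_assoc, mul_assoc _ y a, (hx _).1],
        by rw [mul_assoc a, mul_assoc a, (hx y).2, mul_zero]⟩
    | right_absorb b x _ hx =>
      exact fun y => ⟨by rw [← mul_assoc, (hx y).1, zero_mul],
        by rw [mul_assoc x, (hx _).2]⟩
  intro x hx
  have h := key x hx (vertex E K w)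
  rwa [vertex_mul_self, mul_assoc, vertex_mul_self] at h

/-- The vertices in the annihilator of a graded ideal. -/
theorem IsGraded.vertexSet_perpIdeal (hE : E.RowFinite)
    {J : TwoSidedIdeal (LeavittPathAlgebra E K)} (hJ : IsGraded J) :
    vertexSet J.perpIdeal = (vertexSetBar J)ᶜ := by
  ext w
  constructor
  · rintro hw ⟨b, α, hb⟩
    have hb' : vertex E K b ∈ J.perpIdeal := vertex_mem_of_path α hw
    apply vertex_ne_zero K hE b
    rw [← vertex_mul_self]
    exact (TwoSidedIdeal.mem_perpIdeal.1 hb' _ hb).1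
  · intro hw
    change vertex E K w ∈ J.perpIdeal
    rw [hJ.eq_idealOf hE]
    refine vertex_mem_perpIdeal_idealOf fun h hh => Set.disjoint_left.2 ?_
    rintro b ⟨α⟩ ⟨β⟩
    exact hw ⟨b, α, vertex_mem_of_path β hh⟩

theorem IsGraded.perpIdeal_eq_idealOf (hE : E.RowFinite)
    {J : TwoSidedIdeal (LeavittPathAlgebra E K)} (hJ : IsGraded J) :
    J.perpIdeal = idealOf E K (vertexSetBar J)ᶜ := by
  rw [← hJ.vertexSet_perpIdeal hE]
  exact hJ.perpIdeal.eq_idealOf hE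

/-- Since H(J^⊥) is the complement of H̄(J), a vertex w fails to reach H(J^⊥) exactly when
everything it reaches is in H̄(J). -/
theorem IsGraded.compl_vertexSetBar_perpIdeal (hE : E.RowFinite)
    {J : TwoSidedIdeal (LeavittPathAlgebra E K)} (hJ : IsGraded J) :
    (vertexSetBar J.perpIdeal)ᶜ = {w | E.tree w ⊆ vertexSetBar J} := by
  have hvert := hJ.vertexSet_perpIdeal hE
  ext w
  constructor
  · rintro h b ⟨α⟩
    by_contra hb
    exact h ⟨b, α, hvert ▸ hb⟩
  · rintro h ⟨b, α, hb⟩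
    rw [hvert] at hb
    exact hb (h ⟨α⟩)

end GradedIdeals

end LeavittPathAlgebra

theorem proposition3p7 {V : Type*} {Edge : Type*} (E : DirectedGraph V Edge)
    (hE : E.RowFinite) (K : Type*) [Field K]
    (J : TwoSidedIdeal (LeavittPathAlgebra E K)) (hJ : LeavittPathAlgebra.IsGraded J) :
    perp (J : Set (LeavittPathAlgebra E K)) =
        LeavittPathAlgebra.idealOf E K (LeavittPathAlgebra.vertexSetBar J)ᶜ ∧
      perp (perp (J : Set (LeavittPathAlgebra E K))) =
        LeavittPathAlgebra.idealOf E K {w | E.tree w ⊆ LeavittPathAlgebra.vertexSetBar J} ∧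
      (IsRegularIdeal J ↔
        LeavittPathAlgebra.vertexSet J =
          {w | E.tree w ⊆ LeavittPathAlgebra.vertexSetBar J}) := by
  have hset := hJ.compl_vertexSetBar_perpIdeal hE
  -- J^⊥ is itself graded, so the results on annihilators apply to it and describe J^⊥⊥ and its
  -- vertices.
  have hperp := hJ.perpIdeal.perpIdeal_eq_idealOf hE
  have hvert := hJ.perpIdeal.vertexSet_perpIdeal hE
  rw [hset] at hperp hvert
  rw [IsRegularIdeal, ← J.coe_perpIdeal, ← J.perpIdeal.coe_perpIdeal]
  refine ⟨by rw [hJ.perpIdeal_eq_idealOf hE], by rw [hperp], fun h => ?_, fun h => ?_⟩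
  · rw [← hvert, ← SetLike.coe_injective h]
  -- Conversely, J and J^⊥⊥ are generated by the same vertices.
  · rw [hperp, ← h, ← hJ.eq_idealOf hE]
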